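/- For vectors $u,v\in\mathbb R^2$ let $\angle(u,v)\in(-\pi,\pi]$ denote the oriented angle from $u$ to $v$, counted positively clockwise, with $\angle(u,v)=\pi$ for oppositely directed non-zero vectors and $\angle(u,v)=0$ if $u=0$ or $v=0$. For $A\neq B$ in $\mathbb R^2$ and $0<\psi<\pi$ put $$\mathcal S(A,B,\psi)=\{C\in\mathbb R^2\setminus\{A,B\} : \angle(B-C,\,C-A)\in(-\psi,\psi)\}.$$ Let $n\ge 1$ be an integer, $\varphi\in(0,\pi)$, $n\varphi<\pi$, and $A,B\in\mathbb R^2$, $A\ne B$. Let $\mathcal S^{(n)}(A,B,\varphi)$ be the set of all $(B^{(1)},\dots,B^{(n)})\in(\mathbb R^2)^n$ such that, with $B^{(0)}=A$ and $B^{(n+1)}=B$, $$\angle(B^{(i+1)}-B^{(i)},\,B^{(i)}-B^{(i-1)})\in[-\varphi,\varphi]\ (i=1,\dots,n),\qquad B^{(i)}\neq B^{(i+1)}\ (i=0,\dots,n).$$ Let $Q=[q_1,p_1]\times[q_2,p_2]$ with $q_i<p_i$ be a coordinate rectangle with $\mathcal S(A,B,n\varphi)\subseteq Q$, and for $\tau>0$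 let $Q^{(\tau)}$ be the set of points of $Q$ both of whose coordinates are integer multiples of $\tau$. Put $\mathcal S^{(n)}(Q^{(\tau)},A,B,\varphi)=\mathcal S^{(n)}(A,B,\varphi)\cap[Q^{(\tau)}]^n$. Let $f$ be a real-valued function that is continuous on $\mathcal S^{(n)}(A,B,\varphi)$, let $f^*$ be its infimum over $\mathcal S^{(n)}(A,B,\varphi)$, and suppose that this infimum is attained, i.e. $f(W^*)=f^*$ for some $W^*\in\mathcal S^{(n)}(A,B,\varphi)$. Then the set $\mathcal S^{(n)}(Q^{(\tau)},A,B,\varphi)$ is finite for every $\tau>0$, it is non-empty for all sufficiently small $\tau>0$ (so that the minimum below exists), and $$\lim_{\tau\to0^+}\ \min f\bigl(\mathcal S^{(n)}(Q^{(\tau)},A,B,\varphi)\bigr)=f^*.$$ -/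

import Mathlib

open Set Filter Topology

noncomputable section

/-- The Euclidean plane `ℝ²`. -/
abbrev Plane : Type := EuclideanSpace ℝ (Fin 2)

instance planeFinrankFact : Fact (Module.finrank ℝ Plane = 2) :=
  ⟨by simp⟩

/-- The standard (counterclockwise) orientation of the plane. -/
def planeOrientation : Orientation ℝ Plane (Fin 2) :=
  (EuclideanSpace.basisFun (Fin 2) ℝ).toBasis.orientation

/-- The oriented angle from `u` to `v`, with values in `(-π, π]`, counted positively in the
clockwise direction. It equals `π` for opposite non-zero vectors and `0` if `u = 0` or `v = 0`.
Since Mathlib's `Orientation.oangle` is positive counterclockwise, the clockwise angle from `u`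
to `v` is the counterclockwise one from `v` to `u`. -/
def planeAngle (u v : Plane) : ℝ :=
  (planeOrientation.oangle v u).toReal

/-- Coordinate form of the angle. -/
theorem planeAngle_eq_arg (u v : Plane) :
    planeAngle u v = Complex.arg ⟨u 0 * v 0 + u 1 * v 1, u 1 * v 0 - u 0 * v 1⟩ := by
  have h : planeOrientation.kahler v u
      = (⟨u 0 * v 0 + u 1 * v 1, u 1 * v 0 - u 0 * v 1⟩ : ℂ) := by
    have ha : planeOrientation.areaForm v u = u 1 * v 0 - u 0 * v 1 := by
      rw [Orientation.areaForm_to_volumeForm,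
        planeOrientation.volumeForm_robust (EuclideanSpace.basisFun (Fin 2) ℝ) rfl,
        Module.Basis.det_apply, Matrix.det_fin_two]
      simp [Module.Basis.toMatrix_apply]
      ring
    rw [Orientation.kahler_apply_apply, ha]
    apply Complex.ext <;> simp [PiLp.inner_apply, Fin.sum_univ_two]
  rw [planeAngle, Orientation.oangle, h, Complex.arg_coe_angle_toReal_eq_arg]

/-- `S(A, B, φ)`: the points `C ∉ {A, B}` such that the angle between `B - C` and `C - A`
lies in `(-φ, φ)`. -/
def turnRegion (A B : Plane) (φ : ℝ) : Set Plane :=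
  {C | C ≠ A ∧ C ≠ B ∧ planeAngle (B - C) (C - A) ∈ Ioo (-φ) φ}

/-- The vertices `B⁽⁰⁾ = A, B⁽¹⁾, …, B⁽ⁿ⁾, B⁽ⁿ⁺¹⁾ = B` of the polygonal line from `A` to `B` whose
interior vertices are given by `W`. -/
def pathVertex {n : ℕ} (A B : Plane) (W : Fin n → Plane) : Fin (n + 2) → Plane :=
  Fin.cons A (Fin.snoc W B : Fin (n + 1) → Plane)

/-- `S⁽ⁿ⁾(A, B, φ)`: the tuples of interior vertices of the polygonal lines from `A` to `B` with `n`
interior vertices, with consecutive vertices distinct and every turn angle in `[-φ, φ]`. -/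
def admissiblePaths (n : ℕ) (A B : Plane) (φ : ℝ) : Set (Fin n → Plane) :=
  {W | (∀ i : Fin n,
          planeAngle
            (pathVertex A B W i.succ.succ - pathVertex A B W i.succ.castSucc)
            (pathVertex A B W i.succ.castSucc - pathVertex A B W i.castSucc.castSucc)
              ∈ Icc (-φ) φ) ∧
       (∀ i : Fin (n + 1), pathVertex A B W i.castSucc ≠ pathVertex A B W i.succ)}

/-- The coordinate rectangle `Q = [q₁, p₁] × [q₂, p₂]`. -/
def coordBox (q p : Fin 2 → ℝ) : Set Plane :=
  {C | ∀ i, q i ≤ C i ∧ C i ≤ p i}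

/-- The grid `Q^(τ)`: the points of the rectangle both of whose coordinates are integer
multiples of `τ`. -/
def gridBox (q p : Fin 2 → ℝ) (τ : ℝ) : Set Plane :=
  {C | ∀ i, (∃ j : ℤ, C i = j * τ) ∧ q i ≤ C i ∧ C i ≤ p i}

/-- `S⁽ⁿ⁾(Q^(τ), A, B, φ) = S⁽ⁿ⁾(A, B, φ) ∩ [Q^(τ)]ⁿ`. -/
def gridPaths (n : ℕ) (q p : Fin 2 → ℝ) (τ : ℝ) (A B : Plane) (φ : ℝ) : Set (Fin n → Plane) :=
  admissiblePaths n A B φ ∩ {W | ∀ i, W i ∈ gridBox q p τ}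

end

/-! Grid paths are admissible, so their values are at least `fstar`; what is needed is grid paths
arbitrarily near a minimiser. Rounding an admissible path to the grid may violate a turn bound that
holds with equality, so one passes through the strict paths, whose turns are all less than `φ` in
absolute value. They are (1) open, because `arg` is continuous off the negative axis and `φ < π`
(`isOpen_strictPaths`); (2) dense in the admissible paths: scale every turn by `1 - t`, then restore
the endpoint `B` by a similarity fixing `A` (`admissiblePaths_subset_closure_strictPaths`); (3)
inside `Q`: edge directions differ by less than `n * φ < π`, and sums of vectors in such a sector
stay in it, so `B - C` and `C - A` make an angle less than `n * φ` at each vertex `C`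
(`strictPaths_mem_turnRegion`). Hence a strict path near the minimiser, rounded to a fine grid, is
still strict and lies in `Q`. -/

/-- The identification of the plane with `ℂ`. -/
noncomputable def planeToComplex : Plane ≃ₗᵢ[ℝ] ℂ := Complex.orthonormalBasisOneI.repr.symm

theorem planeToComplex_eq (u : Plane) : planeToComplex u = ⟨u 0, u 1⟩ := by
  rw [planeToComplex, Complex.orthonormalBasisOneI_repr_symm_apply]
  apply Complex.ext <;> simp

theorem planeAngle_eq_arg_mul_conj (u v : Plane) :
    planeAngle u v = Complex.arg (planeToComplex u * starRingEnd ℂ (planeToComplex v)) := by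
  rw [planeAngle_eq_arg, planeToComplex_eq, planeToComplex_eq]
  congr 1
  apply Complex.ext <;> simp [sub_eq_add_neg, add_comm]

/-! ### Sectors of the complex plane -/

/-- A sector of opening less than `π` is a convex cone. Directions are real parameters rather than
values of `arg`, so the branch cut plays no role. -/
theorem exists_polar_add {a b θ₁ θ₂ r₁ r₂ : ℝ} (hab : b - a < Real.pi) (hr₁ : 0 < r₁)
    (hr₂ : 0 < r₂) (h₁ : θ₁ ∈ Icc a b) (h₂ : θ₂ ∈ Icc a b) :
    ∃ r θ : ℝ, 0 < r ∧ θ ∈ Icc a b ∧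
      r₁ * Complex.exp (θ₁ * Complex.I) + r₂ * Complex.exp (θ₂ * Complex.I)
        = r * Complex.exp (θ * Complex.I) := by
  wlog h : θ₁ ≤ θ₂ generalizing θ₁ θ₂ r₁ r₂
  · obtain ⟨r, θ, hr, hθ, he⟩ := this hr₂ hr₁ h₂ h₁ (le_of_not_ge h)
    exact ⟨r, θ, hr, hθ, by rw [← he, add_comm]⟩
  obtain ⟨h1a, h1b⟩ := h₁
  obtain ⟨h2a, h2b⟩ := h₂
  set δ := θ₂ - θ₁ with hδ
  have hδ0 : 0 ≤ δ := by linarith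
  have hδπ : δ < Real.pi := by linarith
  set w : ℂ := r₁ + r₂ * Complex.exp (δ * Complex.I) with hw
  have hre : w.re = r₁ + r₂ * Real.cos δ := by
    simp [hw, Complex.exp_ofReal_mul_I_re]
  have him : w.im = r₂ * Real.sin δ := by
    simp [hw, Complex.exp_ofReal_mul_I_im]
  have hsin : 0 ≤ Real.sin δ := Real.sin_nonneg_of_nonneg_of_le_pi hδ0 hδπ.le
  have hw0 : w ≠ 0 := by
    intro h0
    rcases hδ0.eq_or_lt with hz | hz
    · rw [h0, ← hz] at hre
      simp at hre
      linarith
    · rw [h0] at him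
      have := mul_pos hr₂ (Real.sin_pos_of_pos_of_lt_pi hz hδπ)
      simp at him
      rcases him with him | him <;> simp [him] at this
  have hnorm : 0 < ‖w‖ := norm_pos_iff.2 hw0
  have harg0 : 0 ≤ w.arg := Complex.arg_nonneg_iff.2 (by rw [him]; positivity)
  have hargδ : w.arg ≤ δ := by
    by_contra! hlt
    have hs : 0 < Real.sin (w.arg - δ) :=
      Real.sin_pos_of_pos_of_lt_pi (by linarith)
        (by
          rcases hδ0.eq_or_lt with hz | hz
          · have : w.arg = 0 := by
              rw [Complex.arg_eq_zero_iff, hre, him, ← hz]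
              simp
              positivity
            linarith
          · linarith [Complex.arg_le_pi w])
    -- Both sides are the imaginary part of `w * exp (-δ * I)`; a direction beyond `δ` would make it
    -- positive.
    have h3 : ‖w‖ * Real.sin (w.arg - δ) = - (r₁ * Real.sin δ) := by
      rw [Real.sin_sub, mul_sub, ← mul_assoc, ← mul_assoc, Complex.norm_mul_sin_arg,
        Complex.norm_mul_cos_arg, hre, him]
      ring
    nlinarith [mul_pos hnorm hs, mul_nonneg hr₁.le hsin]
  refine ⟨‖w‖, θ₁ + w.arg, hnorm, ⟨by linarith, by linarith⟩, ?_⟩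
  have e1 : (‖w‖ : ℂ) * Complex.exp ((θ₁ + w.arg : ℝ) * Complex.I)
      = Complex.exp (θ₁ * Complex.I) * w := by
    conv_rhs => rw [← Complex.norm_mul_exp_arg_mul_I w]
    push_cast
    rw [add_mul, Complex.exp_add]
    ring
  have e2 : Complex.exp (θ₂ * Complex.I)
      = Complex.exp (θ₁ * Complex.I) * Complex.exp (δ * Complex.I) := by
    rw [← Complex.exp_add, ← add_mul, hδ]
    push_cast
    ring_nf
  rw [e1, e2, hw]
  ring

theorem exists_polar_sum {ι : Type*} {s : Finset ι} (hs : s.Nonempty) {r θ : ι → ℝ} {a b : ℝ}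
    (hab : b - a < Real.pi) (hr : ∀ i ∈ s, 0 < r i) (hθ : ∀ i ∈ s, θ i ∈ Icc a b) :
    ∃ R Θ : ℝ, 0 < R ∧ Θ ∈ Icc a b ∧
      ∑ i ∈ s, r i * Complex.exp (θ i * Complex.I) = R * Complex.exp (Θ * Complex.I) := by
  induction hs using Finset.Nonempty.cons_induction with
  | singleton i => exact ⟨r i, θ i, hr i (by simp), hθ i (by simp), by simp⟩
  | cons i s hi hs ih =>
    obtain ⟨R, Θ, hR, hΘ, he⟩ := ih (fun j hj => hr j (by simp [hj]))
      (fun j hj => hθ j (by simp [hj]))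
    rw [Finset.sum_cons, he]
    exact exists_polar_add hab (hr i (by simp)) hR (hθ i (by simp)) hΘ

/-- If the directions of two families of vectors differ pairwise by less than `Ψ`, and all the
directions lie in a sector of opening less than `π`, then so do the directions of their sums. -/
theorem abs_arg_sum_mul_conj_sum_lt {ι : Type*} {s t : Finset ι} (hs : s.Nonempty)
    (ht : t.Nonempty) {r θ : ι → ℝ} {Ψ : ℝ} (hΨ : Ψ < Real.pi)
    (hrs : ∀ i ∈ s, 0 < r i) (hrt : ∀ i ∈ t, 0 < r i)
    (hss : ∀ i ∈ s, ∀ j ∈ s, θ i - θ j < Real.pi) (htt : ∀ i ∈ t, ∀ j ∈ t, θ i - θ j < Real.pi)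
    (hst : ∀ i ∈ s, ∀ j ∈ t, |θ i - θ j| < Ψ) :
    ∑ i ∈ s, r i * Complex.exp (θ i * Complex.I) ≠ 0 ∧
    ∑ i ∈ t, r i * Complex.exp (θ i * Complex.I) ≠ 0 ∧
    |Complex.arg ((∑ i ∈ s, r i * Complex.exp (θ i * Complex.I)) *
      starRingEnd ℂ (∑ i ∈ t, r i * Complex.exp (θ i * Complex.I)))| < Ψ := by
  -- The extreme angles are attained, so the strict pairwise bound survives passing to sums.
  obtain ⟨a, ha, ha'⟩ := s.exists_min_image θ hs
  obtain ⟨b, hb, hb'⟩ := s.exists_max_image θ hs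
  obtain ⟨c, hc, hc'⟩ := t.exists_min_image θ ht
  obtain ⟨d, hd, hd'⟩ := t.exists_max_image θ ht
  obtain ⟨R, Θ, hR, hΘ, he⟩ := exists_polar_sum hs (hss b hb a ha) hrs
    (fun i hi => ⟨ha' i hi, hb' i hi⟩)
  obtain ⟨R', Θ', hR', hΘ', he'⟩ := exists_polar_sum ht (htt d hd c hc) hrt
    (fun i hi => ⟨hc' i hi, hd' i hi⟩)
  have h1 := abs_lt.1 (hst a ha d hd)
  have h2 := abs_lt.1 (hst b hb c hc)
  have hlt : |Θ - Θ'| < Ψ := abs_lt.2 ⟨by linarith [hΘ.1, hΘ'.2], by linarith [hΘ.2, hΘ'.1]⟩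
  have hlt' := abs_lt.1 hlt
  rw [he, he']
  refine ⟨by simp [hR.ne'], by simp [hR'.ne'], ?_⟩
  have e : (R * Complex.exp (Θ * Complex.I)) * starRingEnd ℂ (R' * Complex.exp (Θ' * Complex.I))
      = ((R * R' : ℝ) : ℂ) * Complex.exp ((Θ - Θ' : ℝ) * Complex.I) := by
    rw [map_mul, ← Complex.exp_conj, map_mul, Complex.conj_ofReal, Complex.conj_ofReal,
      Complex.conj_I, mul_mul_mul_comm, ← Complex.exp_add]
    push_cast
    ring_nf
  rw [e, Complex.arg_real_mul _ (by positivity), Complex.arg_exp_mul_I,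
    (toIocMod_eq_self Real.two_pi_pos).2 ⟨by linarith, by linarith⟩]
  exact hlt

/-! ### Turns of a sequence of edges -/

/-- The turn from the edge `e k` to the edge `e (k + 1)`. -/
noncomputable def turn (e : ℕ → ℂ) (k : ℕ) : ℝ := Complex.arg (e (k + 1) * starRingEnd ℂ (e k))

/-- The total turn from the edge `e 0` to the edge `e k`. -/
noncomputable def totalTurn (e : ℕ → ℂ) (k : ℕ) : ℝ := ∑ j ∈ Finset.range k, turn e j

/-- The accumulated turns lift the edge directions to `ℝ`, free of jumps by `2π`. -/
theorem eq_norm_mul_exp_totalTurn {e : ℕ → ℂ} {n : ℕ} (he : ∀ k ≤ n, e k ≠ 0) :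
    ∀ k ≤ n, e k = ‖e k‖ * Complex.exp ((Complex.arg (e 0) + totalTurn e k : ℝ) * Complex.I) := by
  intro k
  induction k with
  | zero => intro _; simp [totalTurn, Complex.norm_mul_exp_arg_mul_I]
  | succ k ih =>
    intro hk
    have h0 := he k (by omega)
    have hc : starRingEnd ℂ (e k) ≠ 0 := by simpa using h0
    have ih := ih (by omega)
    apply mul_right_cancel₀ hc
    rw [← Complex.norm_mul_exp_arg_mul_I (e (k + 1) * starRingEnd ℂ (e k))]
    change _ * Complex.exp (turn e k * Complex.I) = _
    have hn : e k * starRingEnd ℂ (e k) = ‖e k‖ * ‖e k‖ := by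
      rw [Complex.mul_conj, Complex.normSq_eq_norm_sq]
      push_cast
      ring
    have : totalTurn e (k + 1) = totalTurn e k + turn e k := Finset.sum_range_succ _ _
    rw [this]
    apply mul_left_cancel₀ (a := (‖e k‖ : ℂ)) (by simpa using h0)
    rw [norm_mul, Complex.norm_conj]
    have h3 : Complex.exp ((Complex.arg (e 0) + (totalTurn e k + turn e k) : ℝ) * Complex.I)
        = Complex.exp ((Complex.arg (e 0) + totalTurn e k : ℝ) * Complex.I) *
          Complex.exp (turn e k * Complex.I) := by
      rw [← Complex.exp_add]
      push_cast
      ring_nf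
    rw [h3]
    rw [Complex.ofReal_mul]
    linear_combination (‖e (k + 1)‖ * Complex.exp (turn e k * Complex.I)) *
      (starRingEnd ℂ (e k) * ih - hn)

theorem abs_totalTurn_sub_lt {e : ℕ → ℂ} {n : ℕ} {φ : ℝ} (h : ∀ k < n, |turn e k| < φ)
    {i j : ℕ} (hij : i < j) (hj : j ≤ n) : |totalTurn e j - totalTurn e i| < n * φ := by
  rw [totalTurn, totalTurn, ← Finset.sum_Ico_eq_sub _ hij.le]
  have hφ : 0 < φ := (abs_nonneg _).trans_lt (h i (by omega))
  calc |∑ k ∈ Finset.Ico i j, turn e k| ≤ ∑ k ∈ Finset.Ico i j, |turn e k| :=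
        Finset.abs_sum_le_sum_abs _ _
    _ < ∑ k ∈ Finset.Ico i j, φ := Finset.sum_lt_sum_of_nonempty (by simpa using hij)
        (fun k hk => h k (by simp at hk; omega))
    _ = ((j - i : ℕ) : ℝ) * φ := by simp
    _ ≤ n * φ := by
      gcongr
      omega

/-- The two sums telescope to (last vertex − vertex `m`) and (vertex `m` − first vertex), so this
bounds the angle at vertex `m`. -/
theorem abs_arg_sum_edges_lt {e : ℕ → ℂ} {n m : ℕ} {φ : ℝ} (he : ∀ k ≤ n, e k ≠ 0)
    (h : ∀ k < n, |turn e k| < φ) (hnφ : n * φ < Real.pi) (hm : 0 < m) (hmn : m ≤ n) :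
    ∑ k ∈ Finset.Ico m (n + 1), e k ≠ 0 ∧ ∑ k ∈ Finset.range m, e k ≠ 0 ∧
    |Complex.arg ((∑ k ∈ Finset.Ico m (n + 1), e k) *
      starRingEnd ℂ (∑ k ∈ Finset.range m, e k))| < n * φ := by
  have hdiff : ∀ i ≤ n, ∀ j ≤ n, totalTurn e i - totalTurn e j < Real.pi := by
    intro i hi j hj
    rcases lt_trichotomy i j with hij | hij | hij
    · have := abs_lt.1 (abs_totalTurn_sub_lt h hij hj)
      linarith
    · simp [hij, Real.pi_pos]
    · have := abs_lt.1 (abs_totalTurn_sub_lt h hij hi)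
      linarith
  have key := abs_arg_sum_mul_conj_sum_lt (s := Finset.Ico m (n + 1)) (t := Finset.range m)
    (r := fun k => ‖e k‖) (θ := fun k => Complex.arg (e 0) + totalTurn e k) (Ψ := n * φ)
    (by simpa using by omega) (by simpa using by omega) hnφ
    (fun k hk => norm_pos_iff.2 (he k (by simp at hk; omega)))
    (fun k hk => norm_pos_iff.2 (he k (by simp at hk; omega)))
    (fun i hi j hj => by
      simp at hi hj
      linarith [hdiff i (by omega) j (by omega)])
    (fun i hi j hj => by
      simp at hi hj
      linarith [hdiff i (by omega) j (by omega)])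
    (fun i hi j hj => by
      simp at hi hj
      rw [add_sub_add_left_eq_sub]
      exact abs_totalTurn_sub_lt h (by omega) (by omega))
  have e1 : ∑ k ∈ Finset.Ico m (n + 1),
      (‖e k‖ : ℂ) * Complex.exp ((Complex.arg (e 0) + totalTurn e k : ℝ) * Complex.I)
        = ∑ k ∈ Finset.Ico m (n + 1), e k :=
    Finset.sum_congr rfl fun k hk =>
      (eq_norm_mul_exp_totalTurn he k (by simp at hk; omega)).symm
  have e2 : ∑ k ∈ Finset.range m,
      (‖e k‖ : ℂ) * Complex.exp ((Complex.arg (e 0) + totalTurn e k : ℝ) * Complex.I)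
        = ∑ k ∈ Finset.range m, e k :=
    Finset.sum_congr rfl fun k hk =>
      (eq_norm_mul_exp_totalTurn he k (by simp at hk; omega)).symm
  simp only [e1, e2] at key
  exact key

/-! ### Paths as sequences of complex numbers -/

/-- The `k`-th vertex of the polygonal line, as a complex number (zero for `k > n + 1`). -/
noncomputable def pathPoint {n : ℕ} (A B : Plane) (W : Fin n → Plane) (k : ℕ) : ℂ :=
  if h : k < n + 2 then planeToComplex (pathVertex A B W ⟨k, h⟩) else 0

/-- The `k`-th edge of the polygonal line, as a complex number. -/
noncomputable def pathEdge {n : ℕ} (A B : Plane) (W : Fin n → Plane) (k : ℕ) : ℂ :=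
  pathPoint A B W (k + 1) - pathPoint A B W k

section

variable {n : ℕ} {A B : Plane} {φ : ℝ}

theorem pathPoint_zero (W : Fin n → Plane) : pathPoint A B W 0 = planeToComplex A := by
  simp [pathPoint, pathVertex]

theorem pathPoint_succ (W : Fin n → Plane) (i : Fin n) :
    pathPoint A B W (i + 1) = planeToComplex (W i) := by
  have h : (⟨(i : ℕ) + 1, by omega⟩ : Fin (n + 2)) = i.castSucc.succ := rfl
  rw [pathPoint, dif_pos (by omega), h, pathVertex, Fin.cons_succ, Fin.snoc_castSucc]

theorem pathPoint_last (W : Fin n → Plane) : pathPoint A B W (n + 1) = planeToComplex B := by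
  have h : (⟨n + 1, by omega⟩ : Fin (n + 2)) = (Fin.last n).succ := rfl
  rw [pathPoint, dif_pos (by omega), h, pathVertex, Fin.cons_succ, Fin.snoc_last]

theorem pathPoint_eq_of_interior {W : Fin n → Plane} {P : ℕ → ℂ} (h0 : P 0 = planeToComplex A)
    (hlast : P (n + 1) = planeToComplex B) (hW : ∀ i : Fin n, planeToComplex (W i) = P (i + 1))
    {k : ℕ} (hk : k ≤ n + 1) : pathPoint A B W k = P k := by
  rcases k with _ | k
  · rw [pathPoint_zero, h0]
  · rcases (Nat.le_of_succ_le_succ hk).eq_or_lt with rfl | hlt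
    · rw [pathPoint_last, hlast]
    · rw [← hW ⟨k, hlt⟩, ← pathPoint_succ]

theorem continuous_pathPoint (k : ℕ) :
    Continuous fun W : Fin n → Plane => pathPoint A B W k := by
  by_cases hk : k ≤ n + 1
  · rcases k with _ | k
    · simp only [pathPoint_zero]
      exact continuous_const
    · rcases (Nat.le_of_succ_le_succ hk).eq_or_lt with rfl | hlt
      · simp only [pathPoint_last]
        exact continuous_const
      · have h : (fun W : Fin n → Plane => pathPoint A B W (k + 1))
            = fun W => planeToComplex (W ⟨k, hlt⟩) :=
          funext fun W => pathPoint_succ W ⟨k, hlt⟩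
        rw [h]
        exact planeToComplex.continuous.comp (continuous_apply _)
  · have h : (fun W : Fin n → Plane => pathPoint A B W k) = fun _ => 0 :=
      funext fun W => dif_neg (by omega)
    rw [h]
    exact continuous_const

theorem continuous_pathEdge (k : ℕ) : Continuous fun W : Fin n → Plane => pathEdge A B W k :=
  (continuous_pathPoint _).sub (continuous_pathPoint _)

theorem sum_range_pathEdge (W : Fin n → Plane) (k : ℕ) :
    ∑ j ∈ Finset.range k, pathEdge A B W j = pathPoint A B W k - planeToComplex A := by
  simp only [pathEdge, Finset.sum_range_sub, pathPoint_zero]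

theorem mem_admissiblePaths_iff {W : Fin n → Plane} :
    W ∈ admissiblePaths n A B φ ↔
      (∀ k < n, |turn (pathEdge A B W) k| ≤ φ) ∧ ∀ k ≤ n, pathEdge A B W k ≠ 0 := by
  have hv : ∀ (k : ℕ) (hk : k < n + 2),
      planeToComplex (pathVertex A B W ⟨k, hk⟩) = pathPoint A B W k :=
    fun k hk => by rw [pathPoint, dif_pos hk]
  have h1 : ∀ (k : ℕ) (hk : k < n),
      planeAngle
        (pathVertex A B W (⟨k, hk⟩ : Fin n).succ.succ -
          pathVertex A B W (⟨k, hk⟩ : Fin n).succ.castSucc)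
        (pathVertex A B W (⟨k, hk⟩ : Fin n).succ.castSucc -
          pathVertex A B W (⟨k, hk⟩ : Fin n).castSucc.castSucc)
        = turn (pathEdge A B W) k := by
    intro k hk
    rw [planeAngle_eq_arg_mul_conj, map_sub, map_sub]
    simp only [Fin.succ_mk, Fin.castSucc_mk, hv]
    rfl
  have h2 : ∀ (k : ℕ) (hk : k < n + 1),
      pathVertex A B W (⟨k, hk⟩ : Fin (n + 1)).castSucc ≠ pathVertex A B W
        (⟨k, hk⟩ : Fin (n + 1)).succ ↔ pathEdge A B W k ≠ 0 := by
    intro k hk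
    rw [pathEdge, sub_ne_zero, ne_comm, ← planeToComplex.injective.ne_iff]
    simp only [Fin.succ_mk, Fin.castSucc_mk, hv]
  rw [admissiblePaths, mem_ofPred_eq, Fin.forall_iff, Fin.forall_iff]
  simp only [h1, h2, mem_Icc, ← abs_le, Nat.lt_succ_iff]

/-- The paths all of whose turns are less than `φ` in absolute value. -/
def strictPaths (n : ℕ) (A B : Plane) (φ : ℝ) : Set (Fin n → Plane) :=
  {W | (∀ k < n, |turn (pathEdge A B W) k| < φ) ∧ ∀ k ≤ n, pathEdge A B W k ≠ 0}

theorem strictPaths_subset : strictPaths n A B φ ⊆ admissiblePaths n A B φ :=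
  fun _ hW => mem_admissiblePaths_iff.2 ⟨fun k hk => (hW.1 k hk).le, hW.2⟩

theorem isOpen_strictPaths (hφ : φ < Real.pi) : IsOpen (strictPaths n A B φ) := by
  rw [isOpen_iff_eventually]
  intro W hW
  refine Filter.Eventually.and ?_ ?_
  · refine (Set.finite_lt_nat n).eventually_all.2 fun k hk => ?_
    have hne : pathEdge A B W (k + 1) * starRingEnd ℂ (pathEdge A B W k) ≠ 0 :=
      mul_ne_zero (hW.2 _ hk) (by simpa using hW.2 k (le_of_lt hk))
    have hslit : pathEdge A B W (k + 1) * starRingEnd ℂ (pathEdge A B W k) ∈ Complex.slitPlane := by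
      rw [Complex.mem_slitPlane_iff_arg]
      refine ⟨fun h => ?_, hne⟩
      have h' : turn (pathEdge A B W) k = Real.pi := h
      have := hW.1 k hk
      rw [h', abs_of_pos Real.pi_pos] at this
      linarith
    have hc : ContinuousAt (fun W' : Fin n → Plane => |turn (pathEdge A B W') k|) W :=
      (ContinuousAt.comp (f := fun W' : Fin n → Plane =>
        pathEdge A B W' (k + 1) * starRingEnd ℂ (pathEdge A B W' k))
        (Complex.continuousAt_arg hslit)
        ((continuous_pathEdge _).mul
          (Complex.continuous_conj.comp (continuous_pathEdge _))).continuousAt).abs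
    exact hc.eventually_lt continuousAt_const (hW.1 k hk)
  · exact (Set.finite_le_nat n).eventually_all.2 fun k hk =>
      (continuous_pathEdge k).continuousAt.eventually_ne (hW.2 k hk)

theorem strictPaths_mem_turnRegion (hnφ : n * φ < Real.pi) {W : Fin n → Plane}
    (hW : W ∈ strictPaths n A B φ) (i : Fin n) : W i ∈ turnRegion A B (n * φ) := by
  obtain ⟨h1, h2, h3⟩ := abs_arg_sum_edges_lt hW.2 hW.1 hnφ (m := i + 1) (by omega) (by omega)
  rw [Finset.sum_Ico_eq_sub _ (by omega)] at h1 h3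
  simp only [sum_range_pathEdge, pathPoint_last, pathPoint_succ, sub_sub_sub_cancel_right,
    ← map_sub] at h1 h2 h3
  rw [← planeAngle_eq_arg_mul_conj] at h3
  simp only [ne_eq, map_eq_zero_iff _ planeToComplex.injective, sub_eq_zero] at h1 h2
  exact ⟨h2, Ne.symm h1, abs_lt.1 h3⟩

/-! ### Density of strict paths -/

/-- The edges of `W`, with the edge `k` rotated back by `t` times the total turn up to it. -/
noncomputable def unbentEdge (A B : Plane) (W : Fin n → Plane) (t : ℝ) (k : ℕ) : ℂ :=
  pathEdge A B W k * Complex.exp ((-(t * totalTurn (pathEdge A B W) k) : ℝ) * Complex.I)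

/-- The path with turns scaled by `1 - t`, moved by a similarity so that it ends at `B`. -/
noncomputable def unbentPoint (A B : Plane) (W : Fin n → Plane) (t : ℝ) (k : ℕ) : ℂ :=
  planeToComplex A + planeToComplex (B - A) / (∑ j ∈ Finset.range (n + 1), unbentEdge A B W t j) *
    ∑ j ∈ Finset.range k, unbentEdge A B W t j

theorem unbentEdge_zero (W : Fin n → Plane) : unbentEdge A B W 0 = pathEdge A B W := by
  ext k
  simp [unbentEdge]

theorem sum_range_unbentEdge_zero (W : Fin n → Plane) :
    ∑ j ∈ Finset.range (n + 1), unbentEdge A B W 0 j = planeToComplex (B - A) := by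
  rw [unbentEdge_zero, sum_range_pathEdge, pathPoint_last, map_sub]

theorem continuous_sum_unbentEdge (W : Fin n → Plane) (k : ℕ) :
    Continuous fun t => ∑ j ∈ Finset.range k, unbentEdge A B W t j := by
  unfold unbentEdge
  fun_prop

/-- Consecutive edges are rotated by amounts differing by `-t` times their turn, and the common
factor `c` cancels. The scaled turn stays in `(-π, π]`, so `arg` returns it unchanged. -/
theorem arg_unbent {W : Fin n → Plane} {c : ℂ} (hc : c ≠ 0) {t : ℝ} (ht : t ∈ Ioo 0 1) {k : ℕ}
    (hk : pathEdge A B W k ≠ 0) (hk' : pathEdge A B W (k + 1) ≠ 0) :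
    Complex.arg (c * unbentEdge A B W t (k + 1) * starRingEnd ℂ (c * unbentEdge A B W t k))
      = (1 - t) * turn (pathEdge A B W) k := by
  set e := pathEdge A B W with he
  have hne : e (k + 1) * starRingEnd ℂ (e k) ≠ 0 := mul_ne_zero hk' (by simpa using hk)
  have h1 : totalTurn e (k + 1) = totalTurn e k + turn e k := Finset.sum_range_succ _ _
  have h2 : c * unbentEdge A B W t (k + 1) * starRingEnd ℂ (c * unbentEdge A B W t k)
      = ((‖c‖ ^ 2 * ‖e (k + 1) * starRingEnd ℂ (e k)‖ : ℝ) : ℂ) *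
        Complex.exp (((1 - t) * turn e k : ℝ) * Complex.I) := by
    have h3 : Complex.exp (((1 - t) * turn e k : ℝ) * Complex.I)
        = Complex.exp (turn e k * Complex.I) *
          (Complex.exp ((-(t * totalTurn e (k + 1)) : ℝ) * Complex.I) *
            Complex.exp ((t * totalTurn e k : ℝ) * Complex.I)) := by
      rw [← Complex.exp_add, ← Complex.exp_add, h1]
      push_cast
      ring_nf
    have h4 : starRingEnd ℂ (Complex.exp ((-(t * totalTurn e k) : ℝ) * Complex.I))
        = Complex.exp ((t * totalTurn e k : ℝ) * Complex.I) := by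
      rw [← Complex.exp_conj, map_mul, Complex.conj_ofReal, Complex.conj_I]
      push_cast
      ring_nf
    have h5 : (‖e (k + 1) * starRingEnd ℂ (e k)‖ : ℂ) * Complex.exp (turn e k * Complex.I)
        = e (k + 1) * starRingEnd ℂ (e k) := Complex.norm_mul_exp_arg_mul_I _
    have h6 : c * starRingEnd ℂ c = ((‖c‖ ^ 2 : ℝ) : ℂ) := by
      rw [Complex.mul_conj, Complex.normSq_eq_norm_sq]
    rw [h3, Complex.ofReal_mul]
    generalize ((‖e (k + 1) * starRingEnd ℂ (e k)‖ : ℝ) : ℂ) = N at *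
    simp only [unbentEdge, ← he, map_mul]
    rw [h4]
    generalize Complex.exp ((-(t * totalTurn e (k + 1)) : ℝ) * Complex.I) = x
    generalize Complex.exp ((t * totalTurn e k : ℝ) * Complex.I) = y
    linear_combination (e (k + 1) * starRingEnd ℂ (e k) * x * y) * h6
      - (((‖c‖ ^ 2 : ℝ) : ℂ) * x * y) * h5
  rw [h2, Complex.arg_real_mul _ (by positivity), Complex.arg_exp_mul_I,
    (toIocMod_eq_self Real.two_pi_pos).2]
  have hl : -Real.pi < turn e k := Complex.neg_pi_lt_arg _
  have hu : turn e k ≤ Real.pi := Complex.arg_le_pi _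
  have := ht.1
  have := ht.2
  constructor <;> nlinarith [Real.pi_pos]

theorem admissiblePaths_subset_closure_strictPaths (hφ : 0 < φ) (hAB : A ≠ B) :
    admissiblePaths n A B φ ⊆ closure (strictPaths n A B φ) := by
  intro W hW
  obtain ⟨hturn, hedge⟩ := mem_admissiblePaths_iff.1 hW
  have hBA : planeToComplex (B - A) ≠ 0 := by
    simpa only [ne_eq, map_eq_zero_iff _ planeToComplex.injective, sub_eq_zero] using hAB.symm
  have hS : ∑ j ∈ Finset.range (n + 1), unbentEdge A B W 0 j ≠ 0 := by
    rwa [sum_range_unbentEdge_zero]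
  set V : ℝ → Fin n → Plane := fun t i => planeToComplex.symm (unbentPoint A B W t (i + 1)) with hV
  have hV0 : V 0 = W := by
    ext1 i
    apply planeToComplex.injective
    rw [hV]
    simp only [LinearIsometryEquiv.apply_symm_apply]
    rw [unbentPoint, sum_range_unbentEdge_zero, div_self hBA, unbentEdge_zero, sum_range_pathEdge,
      pathPoint_succ]
    ring
  have hVc : Tendsto V (𝓝[>] 0) (𝓝 W) := by
    rw [← hV0]
    refine ContinuousAt.tendsto (x := (0 : ℝ)) ?_ |>.mono_left nhdsWithin_le_nhds
    refine continuousAt_pi.2 fun i => planeToComplex.symm.continuous.continuousAt.comp ?_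
    exact continuousAt_const.add ((continuousAt_const.div
      (continuous_sum_unbentEdge W _).continuousAt hS).mul
        (continuous_sum_unbentEdge W _).continuousAt)
  refine mem_closure_of_tendsto hVc ?_
  -- The unbent path must not close up, or no similarity could carry its end to `B`.
  have h1 : ∀ᶠ t in 𝓝[>] (0 : ℝ), ∑ j ∈ Finset.range (n + 1), unbentEdge A B W t j ≠ 0 :=
    ((continuous_sum_unbentEdge W _).continuousAt.eventually_ne hS).filter_mono nhdsWithin_le_nhds
  filter_upwards [h1, Ioo_mem_nhdsGT (zero_lt_one' ℝ)] with t hSt ht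
  have hP : ∀ k ≤ n + 1, pathPoint A B (V t) k = unbentPoint A B W t k := fun k hk =>
    pathPoint_eq_of_interior (by simp [unbentPoint])
      (by rw [unbentPoint, div_mul_cancel₀ _ hSt, map_sub]; ring)
      (fun i => by simp [hV]) hk
  have hE : ∀ k ≤ n, pathEdge A B (V t) k = planeToComplex (B - A) /
      (∑ j ∈ Finset.range (n + 1), unbentEdge A B W t j) * unbentEdge A B W t k := by
    intro k hk
    rw [pathEdge, hP _ (by omega), hP _ (by omega), unbentPoint, unbentPoint,
      Finset.sum_range_succ _ k]
    ring
  have hc := div_ne_zero hBA hSt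
  refine ⟨fun k hk => ?_, fun k hk => ?_⟩
  · rw [turn, hE _ hk, hE _ hk.le, arg_unbent hc ht (hedge _ hk.le) (hedge _ hk), abs_mul,
      abs_of_pos (sub_pos.2 ht.2)]
    have := hturn k hk
    nlinarith [ht.1, ht.2, abs_nonneg (turn (pathEdge A B W) k)]
  · rw [hE k hk]
    exact mul_ne_zero hc (mul_ne_zero (hedge k hk) (Complex.exp_ne_zero _))

end

/-! ### Grids -/

theorem finite_gridBox (q p : Fin 2 → ℝ) {τ : ℝ} (hτ : 0 < τ) : (gridBox q p τ).Finite := by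
  have h : ∀ i, {x : ℝ | (∃ j : ℤ, x = j * τ) ∧ q i ≤ x ∧ x ≤ p i}.Finite := fun i => by
    refine ((Set.finite_Icc ⌊q i / τ⌋ ⌈p i / τ⌉).image fun j : ℤ => (j : ℝ) * τ).subset ?_
    rintro x ⟨⟨j, rfl⟩, h1, h2⟩
    refine ⟨j, ⟨?_, ?_⟩, rfl⟩
    · have : q i / τ ≤ j := (div_le_iff₀ hτ).2 h1
      exact_mod_cast (Int.floor_le _).trans this
    · have : (j : ℝ) ≤ p i / τ := (le_div_iff₀ hτ).2 h2
      exact_mod_cast this.trans (Int.le_ceil _)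
  refine ((Set.Finite.pi' h).preimage
    (WithLp.ofLp_injective 2).injOn).subset fun C hC => ?_
  exact fun i => hC i

theorem finite_gridPaths (n : ℕ) (q p : Fin 2 → ℝ) {τ : ℝ} (hτ : 0 < τ) (A B : Plane) (φ : ℝ) :
    (gridPaths n q p τ A B φ).Finite :=
  (Set.Finite.pi' fun _ => finite_gridBox q p hτ).subset inter_subset_right

theorem tendsto_floor_div_mul (x : ℝ) :
    Tendsto (fun τ : ℝ => (⌊x / τ⌋ : ℝ) * τ) (𝓝[>] 0) (𝓝 x) := by
  have h : Tendsto (fun τ : ℝ => x - τ) (𝓝[>] 0) (𝓝 x) := by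
    have : Tendsto (fun τ : ℝ => x - τ) (𝓝 0) (𝓝 (x - 0)) :=
      (continuous_const.sub continuous_id).tendsto 0
    rw [sub_zero] at this
    exact this.mono_left nhdsWithin_le_nhds
  refine tendsto_of_tendsto_of_tendsto_of_le_of_le' h tendsto_const_nhds ?_ ?_
  · filter_upwards [self_mem_nhdsWithin] with τ (hτ : 0 < τ)
    have h1 := (Int.lt_floor_add_one (x / τ))
    rw [div_lt_iff₀ hτ] at h1
    linarith
  · filter_upwards [self_mem_nhdsWithin] with τ (hτ : 0 < τ)
    exact (le_div_iff₀ hτ).1 (Int.floor_le (x / τ))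

/-- Every neighbourhood of an admissible path contains a path on the grid, if the grid is fine. -/
theorem eventually_exists_mem_gridPaths {n : ℕ} {φ : ℝ} (hφ : φ ∈ Ioo 0 Real.pi)
    (hnφ : n * φ < Real.pi) {A B : Plane} (hAB : A ≠ B) {q p : Fin 2 → ℝ}
    (hQ : turnRegion A B (n * φ) ⊆ coordBox q p) {W : Fin n → Plane}
    (hW : W ∈ admissiblePaths n A B φ) {U : Set (Fin n → Plane)} (hU : U ∈ 𝓝 W) :
    ∀ᶠ τ in 𝓝[>] (0 : ℝ), ∃ V ∈ U, V ∈ gridPaths n q p τ A B φ := by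
  obtain ⟨V, hVU, hV⟩ := mem_closure_iff_nhds.1
    (admissiblePaths_subset_closure_strictPaths hφ.1 hAB hW) _ (interior_mem_nhds.2 hU)
  have hopen : interior U ∩ strictPaths n A B φ ∈ 𝓝 V :=
    (isOpen_interior.inter (isOpen_strictPaths hφ.2)).mem_nhds ⟨hVU, hV⟩
  have hlim : Tendsto (fun (τ : ℝ) (i : Fin n) =>
      (WithLp.toLp 2 fun l => (⌊V i l / τ⌋ : ℝ) * τ : Plane)) (𝓝[>] 0) (𝓝 V) := by
    refine tendsto_pi_nhds.2 fun i => ?_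
    exact ((PiLp.continuous_toLp 2 _).tendsto _).comp
      (tendsto_pi_nhds.2 fun l => tendsto_floor_div_mul (V i l))
  filter_upwards [hlim hopen] with τ hτ
  -- Membership in the box needs no care in rounding: the rounded path is itself strict, so its
  -- vertices lie in the turn region.
  exact ⟨_, interior_subset hτ.1, strictPaths_subset hτ.2, fun i l =>
    ⟨⟨_, rfl⟩, hQ (strictPaths_mem_turnRegion hnφ hτ.2 i) l⟩⟩


theorem mainTheorem5 (n : ℕ) (hn : 1 ≤ n) (φ : ℝ) (hφ : φ ∈ Ioo 0 Real.pi)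
    (hnφ : n * φ < Real.pi) (A B : Plane) (hAB : A ≠ B)
    (q p : Fin 2 → ℝ) (hqp : ∀ i, q i < p i)
    (hQ : turnRegion A B (n * φ) ⊆ coordBox q p)
    (f : (Fin n → Plane) → ℝ) (hf : ContinuousOn f (admissiblePaths n A B φ))
    (fstar : ℝ) (hfstar : IsGLB (f '' admissiblePaths n A B φ) fstar)
    (hreg : ∃ W ∈ admissiblePaths n A B φ, f W = fstar) :
    (∀ τ : ℝ, 0 < τ → (gridPaths n q p τ A B φ).Finite) ∧
    (∀ᶠ τ in 𝓝[>] (0 : ℝ),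
      IsLeast (f '' gridPaths n q p τ A B φ) (sInf (f '' gridPaths n q p τ A B φ))) ∧
    Tendsto (fun τ : ℝ => sInf (f '' gridPaths n q p τ A B φ)) (𝓝[>] 0) (𝓝 fstar) := by
  have hle : ∀ τ, ∀ y ∈ f '' gridPaths n q p τ A B φ, fstar ≤ y := fun τ y hy =>
    hfstar.1 (image_mono inter_subset_left hy)
  obtain ⟨W, hW, hfW⟩ := hreg
  have hmin : ∀ᶠ τ in 𝓝[>] (0 : ℝ),
      IsLeast (f '' gridPaths n q p τ A B φ) (sInf (f '' gridPaths n q p τ A B φ)) := by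
    filter_upwards [self_mem_nhdsWithin,
      eventually_exists_mem_gridPaths hφ hnφ hAB hQ hW univ_mem] with τ hτ ⟨V, _, hV⟩
    have hne : (f '' gridPaths n q p τ A B φ).Nonempty := ⟨_, V, hV, rfl⟩
    exact ⟨hne.csInf_mem ((finite_gridPaths n q p hτ A B φ).image f),
      fun y hy => csInf_le ⟨fstar, hle τ⟩ hy⟩
  refine ⟨fun τ hτ => finite_gridPaths n q p hτ A B φ, hmin, tendsto_order.2 ⟨?_, ?_⟩⟩
  · intro a ha
    filter_upwards [hmin] with τ hτ
    exact ha.trans_le (hle τ _ hτ.1)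
  · intro a ha
    -- `f` is continuous only within the admissible set, hence the implication; grid paths satisfy
    -- its premise.
    have hU : ∀ᶠ V in 𝓝 W, V ∈ admissiblePaths n A B φ → f V < a :=
      eventually_nhdsWithin_iff.1 ((hf W hW).eventually_lt_const (hfW ▸ ha))
    filter_upwards [hmin, eventually_exists_mem_gridPaths hφ hnφ hAB hQ hW hU]
      with τ hτ ⟨V, hVU, hV⟩
    exact (hτ.2 ⟨V, hV, rfl⟩).trans_lt (hVU hV.1)
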